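/- Let $\Theta$ be a parameter set and let $(P_\vartheta)_{\vartheta\in\Theta}$ be probability distributions on $\mathbb R$ with finite means $\mu(\vartheta)$; write $kl(\beta\|\lambda)$ for the Kullback–Leibler divergence $\int \ln\frac{dP_\beta}{dP_\lambda}\,dP_\beta$ (equal to $+\infty$ if $P_\beta\not\ll P_\lambda$). Assume [A1]: (i) $0<kl(\beta\|\lambda)<\infty$ whenever $\mu(\lambda)>\mu(\beta)$; (ii) for all $\varepsilon>0$ and all $\beta,\lambda\in\Theta$ with $\mu(\lambda)>\mu(\beta)$ there is $\eta>0$ such that $|kl(\beta\|\lambda)-kl(\beta\|\lambda')|<\varepsilon$ whenever $\mu(\lambda)\le\mu(\lambda')\le\mu(\lambda)+\eta$; (iii) for all $\lambda\in\Theta$ and $\eta>0$ there is $\lambda'\in\Theta$ with $\mu(\lambda)<\mu(\lambda')<\mu(\lambda)+\eta$. Let $G=(V,E)$ be a finite connected undirected graph. All nodes face the same $K$-armed bandit problem with parameter vector $\boldsymbol\theta=(\theta_1,\dots,\theta_K)\in\Theta^K$: in each round $t=1,2,\dots$ every node $v$ chooses an arm $a^v(t)$ and receives a reward $X^v_{a^v(t)}(t)$,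 where the $X^v_i(t)$ ($v\in V$, $1\le i\le K$, $t\ge1$) are independent and $X^v_i(t)\sim P_{\theta_i}$. A network policy prescribes each $a^v(t)$ as a measurable function of the actions and rewards of $v$ and its neighbours in rounds $1,\dots,t-1$, and possibly of a random seed that is independent of all rewards and whose law does not depend on $\boldsymbol\theta$. Let $m_j^G(n)$ be the total number of times that arm $j$ is chosen by the nodes of $G$ in rounds $1,\dots,n$. Arm $j$ is sub-optimal for $\boldsymbol\theta$ if $\mu(\theta_j)<\max_i\mu(\theta_i)$. Consider a network policy such that, for every $\boldsymbol\theta\in\Theta^K$, every arm $j$ that is sub-optimal for $\boldsymbol\theta$, and every $c>0$, $\mathbb E_{\boldsymbol\theta}[m_j^G(n)]=o(n^c)$ as $n\to\infty$. Then, for every $\boldsymbol\theta\in\Theta^K$, every arm $j$ that is sub-optimal for $\boldsymbol\theta$, every $\theta^*\in\{\theta_1,\dots,\theta_K\}$ with $\mu(\theta^*)=\max_i\mu(\theta_i)$, and every $\delta\in(0,1)$, $$\liminf_{n\to\infty}\frac{\mathbb E_{\boldsymbol\theta}[m_j^G(n)]}{\ln n}\;\ge\;\frac{1-\delta}{1+\delta}\cdot\frac{1}{kl(\theta_j\|\theta^*)}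 .$$ -/

import Mathlib

open MeasureTheory Filter Asymptotics

noncomputable section

namespace NetworkBandit

variable {V Θ S : Type*} {K : ℕ}

/-- The mean of the reward distribution with parameter `a`. -/
def mean (P : Θ → Measure ℝ) (a : Θ) : ℝ := ∫ x, x ∂(P a)

/-- Kullback-Leibler divergence `kl(a ‖ b) = ∫ log (dP_a / dP_b) dP_a`, with values in `[0, ∞]`. -/
def kl (P : Θ → Measure ℝ) (a b : Θ) : ENNReal := InformationTheory.klDiv (P a) (P b)

/-- The regularity assumption on the parametric family of reward distributions. In `continuous`
both divergences are finite by `pos_finite`, so that `toReal` loses nothing. -/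
structure Regular (P : Θ → Measure ℝ) : Prop where
  pos_finite : ∀ β l : Θ, mean P β < mean P l → 0 < kl P β l ∧ kl P β l < ⊤
  continuous : ∀ ε : ℝ, 0 < ε → ∀ β l : Θ, mean P β < mean P l →
    ∃ δ : ℝ, 0 < δ ∧ ∀ l' : Θ, mean P l ≤ mean P l' → mean P l' ≤ mean P l + δ →
      |(kl P β l).toReal - (kl P β l').toReal| < ε
  dense : ∀ l : Θ, ∀ δ : ℝ, 0 < δ → ∃ l' : Θ, mean P l < mean P l' ∧ mean P l' < mean P l + δ

/-- Arm `j` is optimal for the parameter vector `θ`. -/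
def IsOptimal (P : Θ → Measure ℝ) (θ : Fin K → Θ) (j : Fin K) : Prop :=
  ∀ i, mean P (θ i) ≤ mean P (θ j)

/-- Arm `j` is sub-optimal for the parameter vector `θ`. -/
def IsSuboptimal (P : Θ → Measure ℝ) (θ : Fin K → Θ) (j : Fin K) : Prop :=
  ∃ i, mean P (θ j) < mean P (θ i)

/-- The closed neighbourhood of `v`: the node itself and its one-hop neighbours. -/
def closedNbhd (G : SimpleGraph V) (v : V) : Set V := {u | u = v ∨ G.Adj v u}

/-- What node `v` has observed after `t` rounds: the action and the reward of every node of its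
closed neighbourhood in each of these rounds (rounds are numbered from `0`). -/
abbrev History (G : SimpleGraph V) (K : ℕ) (v : V) (t : ℕ) : Type _ :=
  closedNbhd G v → Fin t → Fin K × ℝ

/-- A policy of the network `G`. In each round every node chooses an arm as a measurable function
of its own history and of a random seed, whose law does not depend on the parameters of the arms.
A one-point `S` gives the deterministic policies; a product space `S` with one factor per node
(or per node and round) gives nodes that randomise independently. -/
structure Policy (G : SimpleGraph V) (K : ℕ) (S : Type*) [MeasurableSpace S] where
  seedLaw : Measure S
  isProbabilityMeasure : IsProbabilityMeasure seedLaw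
  choice : (v : V) → (t : ℕ) → S × History G K v t → Fin K
  measurable_choice : ∀ v t, Measurable (choice v t)

/-- A table of rewards: `X (v, i, t)` is the reward that node `v` gets if it plays arm `i` in
round `t`. -/
abbrev RewardTable (V : Type*) (K : ℕ) : Type _ := V × Fin K × ℕ → ℝ

/-- The action of node `v` in round `t`, for the seed `s` and the rewards `X`. -/
def Policy.action {G : SimpleGraph V} [MeasurableSpace S] (Φ : Policy G K S)
    (s : S) (X : RewardTable V K) (t : ℕ) (v : V) : Fin K :=
  Φ.choice v t (s, fun u k => (Φ.action s X k u, X (u, Φ.action s X k u, k)))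
termination_by t
decreasing_by all_goals exact k.2

/-- The number of times arm `j` is chosen by all nodes together in the first `n` rounds. -/
def Policy.count {G : SimpleGraph V} [Fintype V] [MeasurableSpace S] (Φ : Policy G K S)
    (j : Fin K) (n : ℕ) (s : S) (X : RewardTable V K) : ℕ :=
  ∑ v : V, ∑ t ∈ Finset.range n, if Φ.action s X t v = j then 1 else 0

/-- The joint law of seed and rewards under the parameter vector `θ`: all the rewards and the seed
are independent, and the rewards of arm `i` have the law `P (θ i)`. -/
def Policy.law {G : SimpleGraph V} [MeasurableSpace S] (Φ : Policy G K S)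
    (P : Θ → Measure ℝ) [∀ a, IsProbabilityMeasure (P a)] (θ : Fin K → Θ) :
    Measure (S × RewardTable V K) :=
  Φ.seedLaw.prod (Measure.infinitePi fun p : V × Fin K × ℕ => P (θ p.2.1))

/-- The expected number of times arm `j` is chosen by all nodes together in the first `n` rounds,
under the parameter vector `θ`. -/
def Policy.expectedCount {G : SimpleGraph V} [Fintype V] [MeasurableSpace S] (Φ : Policy G K S)
    (P : Θ → Measure ℝ) [∀ a, IsProbabilityMeasure (P a)] (θ : Fin K → Θ) (j : Fin K) (n : ℕ) :
    ℝ :=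
  ∫ ω, (Φ.count j n ω.1 ω.2 : ℝ) ∂(Φ.law P θ)

/-- For every parameter vector and every arm that is sub-optimal for it, the expected network-wide
count of the arm is `o(n ^ c)` for all `c > 0`. -/
def Policy.Consistent {G : SimpleGraph V} [Fintype V] [MeasurableSpace S] (Φ : Policy G K S)
    (P : Θ → Measure ℝ) [∀ a, IsProbabilityMeasure (P a)] : Prop :=
  ∀ θ : Fin K → Θ, ∀ j : Fin K, IsSuboptimal P θ j → ∀ c : ℝ, 0 < c →
    (fun n : ℕ => Φ.expectedCount P θ j n) =o[atTop] (fun n : ℕ => (n : ℝ) ^ c)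

end NetworkBandit

end

/-! ### Densities on finite products -/

namespace NetworkBandit

/-! Change of measure. Replace `θ j` by some `l` whose mean slightly exceeds the optimal one; call
the result `θ'`. Arm `j` is then the only optimal arm, so under `θ'` the fraction `u` of plays spent
on the other arms has mean `o(n ^ (c - 1))`, while under `θ` the mean of `u` tends to `1`. Telling
the two apart costs information, and information is gained only by playing `j`.

Quantitatively, let `L` be the log-likelihood ratio of the observed rewards of `j`. A Wald identity
(`Policy.integral_logLikelihood`) gives `E_θ L = E_θ[m_j] * kl`. A Donsker–Varadhan bound
(`Policy.integral_le_kl_mul_expectedCount_add_log_two`) says `E_θ W ≤ E_θ L + log 2` whenever `E_θ'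
exp W ≤ 2`. Taking `W = (1 - c) * log n * u` and letting `n → ∞` yields the rate `(1 - c) / kl (θ j)
l` (`Policy.Consistent.le_liminf_of_alternative`). Finally `c = δ`, and `l` is so close to the
optimum that its divergence is at most `1 + δ` times the optimal one. -/

lemma withDensity_prod_le_pi {ι : Type*} [Fintype ι] (μ ν : ι → Measure ℝ)
    [∀ i, IsProbabilityMeasure (μ i)] [∀ i, IsProbabilityMeasure (ν i)] (h : ι → ℝ → ENNReal)
    (hm : ∀ i, Measurable (h i)) (hle : ∀ i, (μ i).withDensity (h i) ≤ ν i) :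
    (Measure.pi μ).withDensity (fun x => ∏ i, h i (x i)) ≤ Measure.pi ν := by
  -- On measurable boxes the integral of the product density factorises, by independence of the
  -- coordinates.
  have hbox : ∀ s : ι → Set ℝ, (∀ i, MeasurableSet (s i)) →
      (Measure.pi μ).withDensity (fun x => ∏ i, h i (x i)) (Set.univ.pi s) ≤ ∏ i, ν i (s i) := by
    intro s hs
    have hS : MeasurableSet (Set.univ.pi s) := MeasurableSet.univ_pi hs
    have hprod : (Set.univ.pi s).indicator (fun x : ι → ℝ => ∏ i, h i (x i)) =
        fun x => ∏ i, (s i).indicator (h i) (x i) := by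
      classical
      funext x
      by_cases hx : x ∈ Set.univ.pi s
      · rw [Set.indicator_of_mem hx]
        exact Finset.prod_congr rfl fun i _ => (Set.indicator_of_mem (hx i trivial) _).symm
      · rw [Set.indicator_of_notMem hx]
        simp only [Set.mem_pi, not_forall] at hx
        obtain ⟨i, _, hi⟩ := hx
        exact (Finset.prod_eq_zero (Finset.mem_univ i) (Set.indicator_of_notMem hi _)).symm
    rw [withDensity_apply _ hS, ← lintegral_indicator hS, hprod]
    have hmi : ∀ i, Measurable ((s i).indicator (h i)) := fun i => (hm i).indicator (hs i)
    have hind : ProbabilityTheory.iIndepFun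
        (fun i (x : ι → ℝ) => (s i).indicator (h i) (x i)) (Measure.pi μ) :=
      ProbabilityTheory.iIndepFun_pi (X := fun i => (s i).indicator (h i))
        fun i => (hmi i).aemeasurable
    rw [ProbabilityTheory.lintegral_prod_eq_prod_lintegral_of_indepFun _ _ hind
      fun i => (hmi i).comp (measurable_pi_apply i)]
    refine Finset.prod_le_prod' fun i _ => ?_
    rw [(measurePreserving_eval μ i).lintegral_comp (hmi i), lintegral_indicator (hs i),
      ← withDensity_apply _ (hs i)]
    exact hle i _
  -- `OuterMeasure.pi` is the largest outer measure dominated by the product on boxes. These boxes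
  -- need not be measurable, hence the measurable hulls.
  have hout : ((Measure.pi μ).withDensity (fun x => ∏ i, h i (x i))).toOuterMeasure ≤
      OuterMeasure.pi fun i => (ν i).toOuterMeasure := by
    rw [OuterMeasure.le_pi]
    intro s _
    refine (measure_mono (Set.pi_mono fun i _ => subset_toMeasurable (ν i) (s i))).trans
      ((hbox _ fun i => measurableSet_toMeasurable _ _).trans_eq ?_)
    exact Finset.prod_congr rfl fun i _ => measure_toMeasurable _
  refine Measure.le_iff.2 fun s hs => ?_
  rw [Measure.pi_def (μ := ν), toMeasure_apply _ _ hs]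
  exact hout s

/-! ### Actions as functions of the collected rewards -/

variable {V Θ S : Type*} {K : ℕ} {G : SimpleGraph V} [MeasurableSpace S]

/-- Only the rewards of arms actually played enter a history. -/
lemma Policy.action_congr (Φ : Policy G K S) (s : S) {X Y : RewardTable V K} (t : ℕ)
    (h : ∀ k < t, ∀ u, X (u, Φ.action s X k u, k) = Y (u, Φ.action s X k u, k)) :
    Φ.action s X t = Φ.action s Y t := by
  induction t using Nat.strong_induction_on with
  | _ t ih =>
    have h' : ∀ k < t, Φ.action s X k = Φ.action s Y k := fun k hk =>
      ih k hk fun l hl u => h l (hl.trans hk) u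
    funext v
    rw [Policy.action, Policy.action]
    congr 2
    funext u k
    rw [h k k.2 u, h' k k.2]

lemma Policy.measurable_action (Φ : Policy G K S) (t : ℕ) (v : V) :
    Measurable fun ω : S × RewardTable V K => Φ.action ω.1 ω.2 t v := by
  induction t using Nat.strong_induction_on generalizing v with
  | _ t ih =>
    have heq : (fun ω : S × RewardTable V K => Φ.action ω.1 ω.2 t v) = fun ω =>
        Φ.choice v t (ω.1, fun u k => (Φ.action ω.1 ω.2 k u, ω.2 (u, Φ.action ω.1 ω.2 k u, k))) := by
      funext ω
      rw [Policy.action]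
    rw [heq]
    refine (Φ.measurable_choice v t).comp (measurable_fst.prodMk
      (measurable_pi_lambda _ fun u => measurable_pi_lambda _ fun k => (ih k k.2 u).prodMk ?_))
    have hev : Measurable fun q : Fin K × RewardTable V K => q.2 ((u : V), q.1, (k : ℕ)) :=
      measurable_from_prod_countable_right fun i =>
        measurable_pi_apply ((u : V), i, (k : ℕ))
    exact hev.comp ((ih k k.2 u).prodMk measurable_snd)

/-- The actions of all nodes in the first `n` rounds. -/
def Policy.actions (Φ : Policy G K S) (n : ℕ) (s : S) (X : RewardTable V K) :
    Fin n → V → Fin K :=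
  fun t => Φ.action s X t

/-- The joint law of all rewards under the parameter vector `θ`. -/
noncomputable abbrev rewardLaw (V : Type*) {Θ : Type*} {K : ℕ} (P : Θ → Measure ℝ)
    [∀ a, IsProbabilityMeasure (P a)] (θ : Fin K → Θ) : Measure (RewardTable V K) :=
  Measure.infinitePi fun p : V × Fin K × ℕ => P (θ p.2.1)

variable (P : Θ → Measure ℝ) [∀ a, IsProbabilityMeasure (P a)]

/-- The reward table in which, before round `n`, the reward of every arm is prescribed by `y`. -/
def tableOf (K n : ℕ) (y : V × Fin n → ℝ) : RewardTable V K :=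
  fun p => if h : p.2.2 < n then y (p.1, ⟨p.2.2, h⟩) else 0

lemma measurable_tableOf (K n : ℕ) : Measurable (tableOf (V := V) K n) := by
  refine measurable_pi_lambda _ fun p => ?_
  unfold tableOf
  split_ifs with h
  · exact measurable_pi_apply _
  · exact measurable_const

/-- The event that the actions equal `a` depends only on the rewards along `a`. So `tableOf` may pay
the same reward for every arm: the unplayed entries are never read. -/
lemma Policy.actions_eq_iff (Φ : Policy G K S) (n : ℕ) (s : S) (X : RewardTable V K)
    (a : Fin n → V → Fin K) :
    Φ.actions n s X = a ↔
      Φ.actions n s (tableOf K n fun q : V × Fin n => X (q.1, a q.2 q.1, q.2)) = a := by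
  have key : ∀ Y Z : RewardTable V K,
      (∀ u (k : Fin n), Y (u, a k u, k) = Z (u, a k u, k)) →
      Φ.actions n s Y = a → Φ.actions n s Z = a := by
    intro Y Z hYZ hY
    rw [← hY]
    funext t
    refine (Φ.action_congr s t fun k hk u => ?_).symm
    have hk' : Φ.action s Y k = a ⟨k, hk.trans t.2⟩ := congrFun hY ⟨k, hk.trans t.2⟩
    rw [hk']
    exact hYZ u ⟨k, hk.trans t.2⟩
  exact ⟨key _ _ fun u k => by simp [tableOf], key _ _ fun u k => by simp [tableOf]⟩

lemma Policy.measurable_actions (Φ : Policy G K S) (n : ℕ) :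
    Measurable fun ω : S × RewardTable V K => Φ.actions n ω.1 ω.2 :=
  measurable_pi_lambda _ fun t => measurable_pi_lambda _ fun v => Φ.measurable_action t v

/-! ### Change of measure and independence along the trajectory -/

variable [Fintype V]

/-- After splitting over the finitely many action arrays `a`, both the event and the weight live on
the coordinates played by `a`, where the reward law is a finite product. -/
lemma Policy.lintegral_actions_mul_le (Φ : Policy G K S) (θ θ' : Fin K → Θ) (h : Fin K → ℝ → ENNReal)
    (hm : ∀ i, Measurable (h i)) (hle : ∀ i, (P (θ i)).withDensity (h i) ≤ P (θ' i)) (n : ℕ) (s : S)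
    (g : (Fin n → V → Fin K) → ENNReal) :
    ∫⁻ X, g (Φ.actions n s X) * ∏ q : V × Fin n,
        h (Φ.actions n s X q.2 q.1) (X (q.1, Φ.actions n s X q.2 q.1, q.2)) ∂rewardLaw V P θ ≤
      ∫⁻ X, g (Φ.actions n s X) ∂rewardLaw V P θ' := by
  classical
  have hms : Measurable (Φ.actions n s) :=
    (Φ.measurable_actions n).comp measurable_prodMk_left
  have split : ∀ F : (Fin n → V → Fin K) → RewardTable V K → ENNReal, ∀ X,
      F (Φ.actions n s X) X = ∑ a, {X | Φ.actions n s X = a}.indicator (F a) X := by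
    intro F X
    rw [Finset.sum_eq_single (Φ.actions n s X)]
    · exact (Set.indicator_of_mem (by rfl) _).symm
    · intro a _ ha
      exact Set.indicator_of_notMem (fun hX => ha hX.symm) _
    · simp
  have hmA : ∀ a, MeasurableSet {X | Φ.actions n s X = a} := fun a =>
    hms (measurableSet_singleton a)
  have hmw : ∀ a : Fin n → V → Fin K, Measurable fun X : RewardTable V K =>
      ∏ q : V × Fin n, h (a q.2 q.1) (X (q.1, a q.2 q.1, q.2)) := fun a =>
    Finset.measurable_prod _ fun q _ => (hm _).comp (measurable_pi_apply _)
  rw [lintegral_congr (split fun a X => g a * ∏ q : V × Fin n,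
      h (a q.2 q.1) (X (q.1, a q.2 q.1, q.2))), lintegral_congr (split fun a _ => g a),
    lintegral_finsetSum _ fun a _ => ((hmw a).const_mul _).indicator (hmA a),
    lintegral_finsetSum _ fun a _ => measurable_const.indicator (hmA a)]
  refine Finset.sum_le_sum fun a _ => ?_
  rw [lintegral_indicator (hmA a), lintegral_indicator (hmA a), lintegral_const_mul _ (hmw a),
    lintegral_const, Measure.restrict_apply_univ]
  refine mul_le_mul_right ?_ _
  let c : V × Fin n → V × Fin K × ℕ := fun q => (q.1, a q.2 q.1, q.2)
  -- Node and round already identify the coordinate, so no reward is weighted twice.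
  have hc : Function.Injective c := by
    rintro ⟨u, k⟩ ⟨u', k'⟩ hq
    simp only [c, Prod.mk.injEq] at hq
    exact Prod.ext hq.1 (Fin.ext hq.2.2)
  have hmc : Measurable fun (X : RewardTable V K) q => X (c q) :=
    measurable_pi_lambda _ fun q => measurable_pi_apply _
  have hmap : ∀ η : Fin K → Θ, (rewardLaw V P η).map (fun X q => X (c q)) =
      Measure.pi fun q => P (η (a q.2 q.1)) := fun η => by
    rw [rewardLaw, Measure.map_infinitePi_infinitePi_of_inj hc, Measure.infinitePi_eq_pi]
  let B : Set (V × Fin n → ℝ) := {y | Φ.actions n s (tableOf K n y) = a}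
  have hB : MeasurableSet B :=
    (hms.comp (measurable_tableOf K n)) (measurableSet_singleton a)
  have hpre : {X | Φ.actions n s X = a} = (fun (X : RewardTable V K) q => X (c q)) ⁻¹' B := by
    ext X
    exact Φ.actions_eq_iff n s X a
  have hmB : Measurable fun y : V × Fin n → ℝ => ∏ q, h (a q.2 q.1) (y q) :=
    Finset.measurable_prod _ fun q _ => (hm _).comp (measurable_pi_apply _)
  rw [hpre, ← Measure.map_apply hmc hB, hmap, ← setLIntegral_map hB hmB hmc, hmap,
    ← withDensity_apply _ hB]
  exact withDensity_prod_le_pi (fun q : V × Fin n => P (θ (a q.2 q.1)))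
    (fun q => P (θ' (a q.2 q.1))) (fun q => h (a q.2 q.1)) (fun q => hm _) (fun q => hle _) B

/-- For a fixed seed, the action in round `t` is a function of rewards from rounds before `t`. -/
lemma Policy.indepFun_action_reward (Φ : Policy G K S) (θ : Fin K → Θ) (s : S) (t : ℕ) (v : V)
    (j : Fin K) :
    ProbabilityTheory.IndepFun (fun X => Φ.action s X t v) (fun X => X (v, j, t))
      (rewardLaw V P θ) := by
  classical
  let T : Finset (V × Fin K × ℕ) := Finset.univ ×ˢ Finset.univ ×ˢ Finset.range t
  have hI : ProbabilityTheory.iIndepFun (fun p (X : RewardTable V K) => X p) (rewardLaw V P θ) :=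
    ProbabilityTheory.iIndepFun_infinitePi (X := fun _ x => x) fun _ => measurable_id
  have hTS := hI.indepFun_finset T {(v, j, t)} (by simp [T]) fun p => measurable_pi_apply p
  let e : (T → ℝ) → RewardTable V K := fun x p => if h : p ∈ T then x ⟨p, h⟩ else 0
  have he : Measurable e := by
    refine measurable_pi_lambda _ fun p => ?_
    by_cases h : p ∈ T
    · simp only [e, h, dite_true]
      exact measurable_pi_apply _
    · simp only [e, h, dite_false]
      exact measurable_const
  have hψ : Measurable fun x : ({(v, j, t)} : Finset (V × Fin K × ℕ)) → ℝ =>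
      x ⟨(v, j, t), Finset.mem_singleton_self _⟩ := measurable_pi_apply _
  have h := hTS.comp
    (φ := fun x => Φ.action s (e x) t v)
    (ψ := fun x => x ⟨(v, j, t), Finset.mem_singleton_self _⟩)
    (((Φ.measurable_action t v).comp measurable_prodMk_left).comp he) hψ
  have hact : (fun X => Φ.action s X t v) =
      (fun x => Φ.action s (e x) t v) ∘ fun (X : RewardTable V K) (p : T) => X p := by
    funext X
    refine congrFun (Φ.action_congr s t fun k hk u => ?_) v
    simp [e, T, hk]
  rw [hact]
  exact h

end NetworkBandit
-- Log-likelihood ratio and the information inequality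
namespace NetworkBandit

variable {V Θ S : Type*} {K : ℕ} {G : SimpleGraph V} [MeasurableSpace S]
  (P : Θ → Measure ℝ) [∀ a, IsProbabilityMeasure (P a)]

lemma Policy.isProbabilityMeasure_law (Φ : Policy G K S) (θ : Fin K → Θ) :
    IsProbabilityMeasure (Φ.law P θ) := by
  have := Φ.isProbabilityMeasure
  unfold Policy.law
  infer_instance

variable [Fintype V]

lemma Policy.count_eq_sum_actions (Φ : Policy G K S) (j : Fin K) (n : ℕ) (s : S)
    (X : RewardTable V K) :
    Φ.count j n s X = ∑ q : V × Fin n, if Φ.actions n s X q.2 q.1 = j then 1 else 0 := by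
  rw [Policy.count, Fintype.sum_prod_type]
  exact Finset.sum_congr rfl fun v _ => Finset.sum_range _

/-- The accumulated log-likelihood ratio of the rewards of arm `j` in the first `n` rounds. -/
noncomputable def Policy.logLikelihood (Φ : Policy G K S) (ℓ : ℝ → ℝ) (j : Fin K) (n : ℕ) (s : S)
    (X : RewardTable V K) : ℝ :=
  ∑ q : V × Fin n, if Φ.actions n s X q.2 q.1 = j then ℓ (X (q.1, j, q.2)) else 0

/-- The weight is `dν/dμ` almost everywhere for `μ`; equality can fail because `ν` may have a part
singular to `μ`. -/
lemma withDensity_exp_neg_llr_le (μ ν : Measure ℝ) [IsProbabilityMeasure μ]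
    [IsProbabilityMeasure ν] (h : μ ≪ ν) :
    μ.withDensity (fun x => ENNReal.ofReal (Real.exp (-llr μ ν x))) ≤ ν := by
  have hae : (fun x => ENNReal.ofReal (Real.exp (-llr μ ν x))) =ᵐ[μ] ν.rnDeriv μ := by
    filter_upwards [exp_neg_llr h, Measure.rnDeriv_lt_top ν μ] with x hx hx'
    rw [hx, ENNReal.ofReal_toReal hx'.ne]
  rw [withDensity_congr_ae hae]
  exact Measure.withDensity_rnDeriv_le ν μ

lemma Policy.lintegral_exp_neg_logLikelihood_le (Φ : Policy G K S) (θ : Fin K → Θ) (j : Fin K)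
    (l : Θ) (h : P (θ j) ≪ P l) (n : ℕ) (g : (Fin n → V → Fin K) → ENNReal) :
    ∫⁻ ω, g (Φ.actions n ω.1 ω.2) * ENNReal.ofReal
        (Real.exp (-Φ.logLikelihood (llr (P (θ j)) (P l)) j n ω.1 ω.2)) ∂Φ.law P θ ≤
      ∫⁻ ω, g (Φ.actions n ω.1 ω.2) ∂Φ.law P (Function.update θ j l) := by
  have := Φ.isProbabilityMeasure
  set ℓ := llr (P (θ j)) (P l)
  have hmℓ : Measurable ℓ := measurable_llr _ _
  have hma : ∀ q : V × Fin n, Measurable fun ω : S × RewardTable V K =>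
      Φ.actions n ω.1 ω.2 q.2 q.1 := fun q => Φ.measurable_action q.2 q.1
  have hmL : Measurable fun ω : S × RewardTable V K => Φ.logLikelihood ℓ j n ω.1 ω.2 :=
    Finset.measurable_sum _ fun q _ => Measurable.ite (hma q (measurableSet_singleton j))
      (hmℓ.comp ((measurable_pi_apply _).comp measurable_snd)) measurable_const
  have hmg : Measurable fun ω : S × RewardTable V K => g (Φ.actions n ω.1 ω.2) :=
    (measurable_of_countable g).comp (Φ.measurable_actions n)
  have hmF : Measurable fun ω : S × RewardTable V K => g (Φ.actions n ω.1 ω.2) *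
      ENNReal.ofReal (Real.exp (-Φ.logLikelihood ℓ j n ω.1 ω.2)) := hmg.mul (by fun_prop)
  rw [Policy.law, Policy.law, lintegral_prod _ hmF.aemeasurable, lintegral_prod _ hmg.aemeasurable]
  refine lintegral_mono fun s => ?_
  refine le_trans (le_of_eq ?_) (Φ.lintegral_actions_mul_le P θ (Function.update θ j l)
    -- Only arm `j` changes its law, so the other arms carry density `1`.
    (fun i x => if i = j then ENNReal.ofReal (Real.exp (-ℓ x)) else 1) ?_ ?_ n s g)
  · refine lintegral_congr fun X => ?_
    congr 1
    simp only [Policy.logLikelihood]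
    rw [← Finset.sum_neg_distrib, Real.exp_sum, ENNReal.ofReal_prod_of_nonneg
      fun _ _ => (Real.exp_pos _).le]
    refine Finset.prod_congr rfl fun q _ => ?_
    split_ifs with hq
    · rw [hq]
    · simp
  · intro i
    by_cases hi : i = j
    · simp only [hi, if_true]
      fun_prop
    · simp only [hi, if_false]
      exact measurable_const
  · intro i
    by_cases hi : i = j
    · subst hi
      simpa using withDensity_exp_neg_llr_le _ _ h
    · simp only [hi, if_false, Function.update_of_ne hi]
      exact (withDensity_one (μ := P (θ i))).le

lemma Policy.integrable_ite_reward (Φ : Policy G K S) (θ : Fin K → Θ) (j : Fin K) (ℓ : ℝ → ℝ)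
    (hmℓ : Measurable ℓ) (hℓ : Integrable ℓ (P (θ j))) (t : ℕ) (v : V) :
    Integrable (fun ω => if Φ.action ω.1 ω.2 t v = j then ℓ (ω.2 (v, j, t)) else 0)
      (Φ.law P θ) := by
  have := Φ.isProbabilityMeasure
  have h1 : Integrable (fun X : RewardTable V K => ℓ (X (v, j, t))) (rewardLaw V P θ) :=
    (measurePreserving_eval_infinitePi (fun p : V × Fin K × ℕ => P (θ p.2.1)) (v, j, t)
      ).integrable_comp_of_integrable hℓ
  have h2 : Integrable (fun ω : S × RewardTable V K => ℓ (ω.2 (v, j, t))) (Φ.law P θ) :=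
    h1.comp_snd _
  refine h2.mono (Measurable.ite (Φ.measurable_action t v (measurableSet_singleton j))
    (hmℓ.comp ((measurable_pi_apply _).comp measurable_snd))
    measurable_const).aestronglyMeasurable
    (ae_of_all _ fun ω => ?_)
  split_ifs
  · exact le_rfl
  · simp

lemma Policy.integral_ite_reward (Φ : Policy G K S) (θ : Fin K → Θ) (j : Fin K) (ℓ : ℝ → ℝ)
    (hmℓ : Measurable ℓ) (hℓ : Integrable ℓ (P (θ j))) (t : ℕ) (v : V) :
    ∫ ω, (if Φ.action ω.1 ω.2 t v = j then ℓ (ω.2 (v, j, t)) else 0) ∂Φ.law P θ =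
      (∫ ω, (if Φ.action ω.1 ω.2 t v = j then 1 else 0) ∂Φ.law P θ) * ∫ x, ℓ x ∂P (θ j) := by
  have := Φ.isProbabilityMeasure
  have hmi : Measurable fun i : Fin K => if i = j then (1 : ℝ) else 0 := measurable_of_countable _
  have hm1 : Measurable fun ω : S × RewardTable V K =>
      if Φ.action ω.1 ω.2 t v = j then (1 : ℝ) else 0 := hmi.comp (Φ.measurable_action t v)
  have hi1 : Integrable (fun ω : S × RewardTable V K =>
      if Φ.action ω.1 ω.2 t v = j then (1 : ℝ) else 0) (Φ.law P θ) := by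
    have := Φ.isProbabilityMeasure_law P θ
    exact Integrable.of_bound hm1.aestronglyMeasurable 1
      (ae_of_all _ fun ω => by split_ifs <;> simp)
  have h2 := Φ.integrable_ite_reward P θ j ℓ hmℓ hℓ t v
  rw [Policy.law] at h2 hi1 ⊢
  rw [integral_prod _ h2, integral_prod _ hi1, ← integral_mul_const]
  refine integral_congr_ae (ae_of_all _ fun s => ?_)
  have hind := (Φ.indepFun_action_reward P θ s t v j).comp hmi hmℓ
  have hmul := hind.integral_fun_mul_eq_mul_integral
    (hm1.comp measurable_prodMk_left).aestronglyMeasurable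
    (hmℓ.comp (measurable_pi_apply _)).aestronglyMeasurable
  have hev : ∫ X : RewardTable V K, ℓ (X (v, j, t)) ∂rewardLaw V P θ = ∫ x, ℓ x ∂P (θ j) := by
    have hmp := measurePreserving_eval_infinitePi (fun p : V × Fin K × ℕ => P (θ p.2.1)) (v, j, t)
    rw [← hmp.map_eq, integral_map hmp.measurable.aemeasurable hmℓ.aestronglyMeasurable]
  simp only [Function.comp_apply, hev, ite_mul, one_mul, zero_mul] at hmul
  exact hmul

lemma Policy.integral_logLikelihood (Φ : Policy G K S) (θ : Fin K → Θ) (j : Fin K) (ℓ : ℝ → ℝ)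
    (hmℓ : Measurable ℓ) (hℓ : Integrable ℓ (P (θ j))) (n : ℕ) :
    Integrable (fun ω => Φ.logLikelihood ℓ j n ω.1 ω.2) (Φ.law P θ) ∧
      ∫ ω, Φ.logLikelihood ℓ j n ω.1 ω.2 ∂Φ.law P θ =
        Φ.expectedCount P θ j n * ∫ x, ℓ x ∂P (θ j) := by
  have := Φ.isProbabilityMeasure_law P θ
  have hi : ∀ q : V × Fin n, Integrable (fun ω : S × RewardTable V K =>
      if Φ.actions n ω.1 ω.2 q.2 q.1 = j then ℓ (ω.2 (q.1, j, q.2)) else 0) (Φ.law P θ) :=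
    fun q => Φ.integrable_ite_reward P θ j ℓ hmℓ hℓ q.2 q.1
  refine ⟨integrable_finsetSum _ fun q _ => hi q, ?_⟩
  simp only [Policy.expectedCount, Policy.count_eq_sum_actions, Policy.logLikelihood,
    Nat.cast_sum, Nat.cast_ite, Nat.cast_one, Nat.cast_zero]
  rw [integral_finsetSum _ fun q _ => hi q, integral_finsetSum, Finset.sum_mul]
  · exact Finset.sum_congr rfl fun q _ => Φ.integral_ite_reward P θ j ℓ hmℓ hℓ q.2 q.1
  · intro q _
    have hmi : Measurable fun i : Fin K => if i = j then (1 : ℝ) else 0 :=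
      measurable_of_countable _
    have hm : Measurable fun ω : S × RewardTable V K =>
        if Φ.actions n ω.1 ω.2 q.2 q.1 = j then (1 : ℝ) else 0 :=
      hmi.comp (Φ.measurable_action q.2 q.1)
    exact Integrable.of_bound hm.aestronglyMeasurable 1
      (ae_of_all _ fun ω => by split_ifs <;> simp)

lemma Policy.integral_le_kl_mul_expectedCount_add_log_two (Φ : Policy G K S) (θ : Fin K → Θ)
    (j : Fin K) (l : Θ) (hkl : kl P (θ j) l ≠ ⊤) (n : ℕ) (W : (Fin n → V → Fin K) → ℝ)
    (hW : ∫⁻ ω, ENNReal.ofReal (Real.exp (W (Φ.actions n ω.1 ω.2)))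
      ∂Φ.law P (Function.update θ j l) ≤ 2) :
    ∫ ω, W (Φ.actions n ω.1 ω.2) ∂Φ.law P θ ≤
      Φ.expectedCount P θ j n * (kl P (θ j) l).toReal + Real.log 2 := by
  have := Φ.isProbabilityMeasure_law P θ
  obtain ⟨hac, hint⟩ := InformationTheory.klDiv_ne_top_iff.1 hkl
  have hmℓ : Measurable (llr (P (θ j)) (P l)) := measurable_llr _ _
  obtain ⟨hLi, hL⟩ := Φ.integral_logLikelihood P θ j _ hmℓ hint n
  have hklr : (kl P (θ j) l).toReal = ∫ x, llr (P (θ j)) (P l) x ∂P (θ j) :=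
    InformationTheory.toReal_klDiv_of_measure_eq hac (by simp)
  rw [hklr, ← hL]
  set L := fun ω : S × RewardTable V K =>
    Φ.logLikelihood (llr (P (θ j)) (P l)) j n ω.1 ω.2
  set w := fun ω : S × RewardTable V K => W (Φ.actions n ω.1 ω.2)
  have hmw : Measurable w := (measurable_of_countable W).comp (Φ.measurable_actions n)
  have hwi : Integrable w (Φ.law P θ) := by
    obtain ⟨C, hC⟩ := (Set.finite_range fun a => ‖W a‖).bddAbove
    exact Integrable.of_bound hmw.aestronglyMeasurable C
      (ae_of_all _ fun ω => hC ⟨_, rfl⟩)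
  have hle : ∫⁻ ω, ENNReal.ofReal (Real.exp (w ω - L ω)) ∂Φ.law P θ ≤ 2 := by
    refine le_trans (le_of_eq (lintegral_congr fun ω => ?_))
      ((Φ.lintegral_exp_neg_logLikelihood_le P θ j l hac n
        fun a => ENNReal.ofReal (Real.exp (W a))).trans hW)
    rw [← ENNReal.ofReal_mul (Real.exp_pos _).le, ← Real.exp_add, sub_eq_add_neg]
  have hexp_m : AEStronglyMeasurable (fun ω => Real.exp (w ω - L ω)) (Φ.law P θ) :=
    Real.continuous_exp.comp_aestronglyMeasurable (hwi.sub hLi).aestronglyMeasurable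
  have hexp_i : Integrable (fun ω => Real.exp (w ω - L ω)) (Φ.law P θ) := by
    refine ⟨hexp_m, ?_⟩
    rw [hasFiniteIntegral_iff_ofReal (ae_of_all _ fun ω => (Real.exp_pos _).le)]
    exact hle.trans_lt (by simp)
  have hexp : ∫ ω, Real.exp (w ω - L ω) ∂Φ.law P θ ≤ 2 := by
    rw [integral_eq_lintegral_of_nonneg_ae (ae_of_all _ fun ω => (Real.exp_pos _).le) hexp_m]
    exact ENNReal.toReal_le_of_le_ofReal (by norm_num) (by simpa using hle)
  -- This is `1 + y ≤ exp y` at `y = w - L - log 2`; integrated, the exponential term contributes at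
  -- most `1` and cancels the `-1`.
  have hpt : ∀ ω, w ω ≤ L ω + (Real.log 2 - 1) + Real.exp (w ω - L ω) / 2 := fun ω => by
    have h := Real.add_one_le_exp (w ω - L ω - Real.log 2)
    rw [Real.exp_sub _ (Real.log 2), Real.exp_log two_pos] at h
    linarith
  have hLc : Integrable (fun ω => L ω + (Real.log 2 - 1)) (Φ.law P θ) :=
    hLi.add (integrable_const _)
  have hmono := integral_mono hwi (hLc.add (hexp_i.div_const 2)) hpt
  rw [integral_add' hLc (hexp_i.div_const 2),
    integral_add hLi (integrable_const _), integral_const, integral_div] at hmono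
  simp only [probReal_univ, one_smul] at hmono
  linarith

end NetworkBandit
-- Asymptotics of the counts and the lower bound
namespace NetworkBandit

variable {V Θ S : Type*} {K : ℕ} {G : SimpleGraph V} [MeasurableSpace S] [Fintype V]
  (P : Θ → Measure ℝ) [∀ a, IsProbabilityMeasure (P a)]

lemma Policy.sum_count (Φ : Policy G K S) (n : ℕ) (s : S) (X : RewardTable V K) :
    ∑ i, Φ.count i n s X = Fintype.card V * n := by
  simp only [Policy.count_eq_sum_actions]
  rw [Finset.sum_comm]
  simp

lemma Policy.count_le (Φ : Policy G K S) (j : Fin K) (n : ℕ) (s : S) (X : RewardTable V K) :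
    Φ.count j n s X ≤ Fintype.card V * n := by
  rw [← Φ.sum_count n s X]
  exact Finset.single_le_sum (f := fun i => Φ.count i n s X) (fun _ _ => Nat.zero_le _)
    (Finset.mem_univ j)

lemma Policy.integrable_count (Φ : Policy G K S) (θ : Fin K → Θ) (j : Fin K) (n : ℕ) :
    Integrable (fun ω => (Φ.count j n ω.1 ω.2 : ℝ)) (Φ.law P θ) := by
  have := Φ.isProbabilityMeasure_law P θ
  have hm : Measurable fun ω : S × RewardTable V K => (Φ.count j n ω.1 ω.2 : ℝ) := by
    simp only [Policy.count_eq_sum_actions]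
    exact (measurable_of_countable fun a : Fin n → V → Fin K =>
      ((∑ q : V × Fin n, if a q.2 q.1 = j then 1 else 0 : ℕ) : ℝ)).comp (Φ.measurable_actions n)
  refine Integrable.of_bound hm.aestronglyMeasurable ((Fintype.card V * n : ℕ) : ℝ)
    (ae_of_all _ fun ω => ?_)
  rw [Real.norm_natCast]
  exact_mod_cast Φ.count_le j n ω.1 ω.2

lemma Policy.sum_expectedCount (Φ : Policy G K S) (θ : Fin K → Θ) (n : ℕ) :
    ∑ i, Φ.expectedCount P θ i n = Fintype.card V * n := by
  have := Φ.isProbabilityMeasure_law P θ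
  simp only [Policy.expectedCount]
  rw [← integral_finsetSum _ fun i _ => Φ.integrable_count P θ i n]
  simp only [← Nat.cast_sum, Φ.sum_count]
  simp

/-- The chord of `exp` between `0` and `x` lies above the graph. It turns the exponential moment of
`u` into its mean, the quantity that consistency controls. -/
lemma exp_mul_le_one_add {x u : ℝ} (hu : 0 ≤ u) (hu' : u ≤ 1) :
    Real.exp (x * u) ≤ 1 + Real.exp x * u := by
  have h := convexOn_exp.2 (Set.mem_univ 0) (Set.mem_univ x) (sub_nonneg.2 hu') hu (by ring)
  simp only [smul_eq_mul, mul_zero, zero_add, Real.exp_zero, mul_one] at h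
  rw [mul_comm x u, mul_comm _ u]
  linarith

lemma Policy.mul_le_kl_mul_expectedCount_add_log_two (Φ : Policy G K S) (θ : Fin K → Θ)
    (j : Fin K) (l : Θ) (hkl : kl P (θ j) l ≠ ⊤) (n : ℕ) (x : ℝ)
    (hx : Real.exp x *
      (1 - Φ.expectedCount P (Function.update θ j l) j n / (Fintype.card V * n)) ≤ 1) :
    x * (1 - Φ.expectedCount P θ j n / (Fintype.card V * n)) ≤
      Φ.expectedCount P θ j n * (kl P (θ j) l).toReal + Real.log 2 := by
  set M : ℝ := Fintype.card V * n with hM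
  let u : (Fin n → V → Fin K) → ℝ := fun a =>
    1 - ((∑ q : V × Fin n, if a q.2 q.1 = j then 1 else 0 : ℕ) : ℝ) / M
  have hu : ∀ ω : S × RewardTable V K,
      u (Φ.actions n ω.1 ω.2) = 1 - (Φ.count j n ω.1 ω.2 : ℝ) / M := fun ω => by
    rw [Policy.count_eq_sum_actions]
  have hu0 : ∀ ω : S × RewardTable V K, 0 ≤ u (Φ.actions n ω.1 ω.2) := fun ω => by
    rw [hu, sub_nonneg]
    -- This also covers `M = 0`, where the quotient is `0` and `u = 1`.
    refine div_le_one_of_le₀ ?_ (by positivity)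
    rw [hM]
    exact_mod_cast Φ.count_le j n ω.1 ω.2
  have hu1 : ∀ ω : S × RewardTable V K, u (Φ.actions n ω.1 ω.2) ≤ 1 := fun ω => by
    rw [hu]
    have : 0 ≤ (Φ.count j n ω.1 ω.2 : ℝ) / M := by positivity
    linarith
  have hui : ∀ η : Fin K → Θ, Integrable (fun ω => u (Φ.actions n ω.1 ω.2)) (Φ.law P η) ∧
      ∫ ω, u (Φ.actions n ω.1 ω.2) ∂Φ.law P η = 1 - Φ.expectedCount P η j n / M := fun η => by
    have := Φ.isProbabilityMeasure_law P η
    have hc := (Φ.integrable_count P η j n).div_const M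
    simp only [hu]
    refine ⟨(integrable_const 1).sub hc, ?_⟩
    rw [integral_sub (integrable_const 1) hc, integral_div]
    simp [Policy.expectedCount]
  have hW := Φ.integral_le_kl_mul_expectedCount_add_log_two P θ j l hkl n (fun a => x * u a) ?_
  · rwa [integral_const_mul, (hui θ).2] at hW
  · obtain ⟨hi', he'⟩ := hui (Function.update θ j l)
    have := Φ.isProbabilityMeasure_law P (Function.update θ j l)
    have hi : Integrable (fun ω : S × RewardTable V K =>
        1 + Real.exp x * u (Φ.actions n ω.1 ω.2)) (Φ.law P (Function.update θ j l)) :=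
      (integrable_const 1).add (hi'.const_mul _)
    calc ∫⁻ ω, ENNReal.ofReal (Real.exp (x * u (Φ.actions n ω.1 ω.2)))
          ∂Φ.law P (Function.update θ j l)
        ≤ ∫⁻ ω, ENNReal.ofReal (1 + Real.exp x * u (Φ.actions n ω.1 ω.2))
          ∂Φ.law P (Function.update θ j l) :=
          lintegral_mono fun ω => ENNReal.ofReal_le_ofReal (exp_mul_le_one_add (hu0 ω) (hu1 ω))
      _ = ENNReal.ofReal (∫ ω, (1 + Real.exp x * u (Φ.actions n ω.1 ω.2))
          ∂Φ.law P (Function.update θ j l)) :=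
          (ofReal_integral_eq_lintegral_ofReal hi (ae_of_all _ fun ω =>
            add_nonneg zero_le_one (mul_nonneg (Real.exp_pos x).le (hu0 ω)))).symm
      _ ≤ ENNReal.ofReal 2 := by
          refine ENNReal.ofReal_le_ofReal ?_
          rw [integral_add (integrable_const 1) (hi'.const_mul _), integral_const_mul, he']
          simp only [integral_const, probReal_univ, smul_eq_mul, mul_one]
          linarith
      _ = 2 := by simp

/-- The asymptotic lower bound against one alternative parameter `l` for the arm `j`. -/
lemma Policy.Consistent.le_liminf_of_alternative [Nonempty V] {Φ : Policy G K S}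
    (hΦ : Φ.Consistent P) {θ : Fin K → Θ} {j : Fin K} (hj : IsSuboptimal P θ j) {l : Θ}
    (hl : ∀ i, mean P (θ i) < mean P l) (hkl0 : 0 < kl P (θ j) l) (hkl : kl P (θ j) l < ⊤)
    {c : ℝ} (hc : 0 < c) :
    (((1 - c) / (kl P (θ j) l).toReal : ℝ) : EReal) ≤
      liminf (fun n : ℕ => ((Φ.expectedCount P θ j n / Real.log n : ℝ) : EReal)) atTop := by
  set θ' := Function.update θ j l with hθ'
  set κ := (kl P (θ j) l).toReal
  have hκ0 : 0 < κ := ENNReal.toReal_pos hkl0.ne' hkl.ne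
  set N : ℝ := (Fintype.card V : ℝ) with hN
  have hN0 : 0 < N := Nat.cast_pos.2 Fintype.card_pos
  have hsub : ∀ i, i ≠ j → IsSuboptimal P θ' i := fun i hi =>
    ⟨j, by simpa [hθ', Function.update_of_ne hi] using hl i⟩
  -- This quantity is `n ^ (1 - c)` times the mean of `u` under `θ'`; being eventually at most `1`,
  -- it allows `x = (1 - c) * log n`.
  have hlim' : Tendsto (fun n : ℕ => (∑ i ∈ Finset.univ.erase j,
      Φ.expectedCount P θ' i n / (n : ℝ) ^ c) / N) atTop (nhds 0) := by
    have h : Tendsto (fun n : ℕ => ∑ i ∈ Finset.univ.erase j,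
        Φ.expectedCount P θ' i n / (n : ℝ) ^ c) atTop (nhds (∑ i ∈ Finset.univ.erase j, (0 : ℝ))) :=
      tendsto_finsetSum _ fun i hi =>
        (hΦ θ' i (hsub i (Finset.ne_of_mem_erase hi)) c hc).tendsto_div_nhds_zero
    simpa using h.div_const N
  have hlim : Tendsto (fun n : ℕ => Φ.expectedCount P θ j n / (N * n)) atTop (nhds 0) := by
    have h := ((hΦ θ j hj 1 one_pos).tendsto_div_nhds_zero).div_const N
    simp only [Real.rpow_one, zero_div, div_div] at h
    simpa only [mul_comm] using h
  have hlog : Tendsto (fun n : ℕ => Real.log n) atTop atTop :=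
    Real.tendsto_log_atTop.comp tendsto_natCast_atTop_atTop
  have hr : Tendsto (fun n : ℕ => ((1 - c) * (1 - Φ.expectedCount P θ j n / (N * n)) -
      Real.log 2 / Real.log n) / κ) atTop (nhds ((1 - c) / κ)) := by
    have h := ((((tendsto_const_nhds (x := (1 : ℝ))).sub hlim).const_mul (1 - c)).sub
      (hlog.const_div_atTop (Real.log 2))).div_const κ
    simpa using h
  have hle : ∀ᶠ n : ℕ in atTop, ((1 - c) * (1 - Φ.expectedCount P θ j n / (N * n)) -
      Real.log 2 / Real.log n) / κ ≤ Φ.expectedCount P θ j n / Real.log n := by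
    filter_upwards [hlim'.eventually_le_const one_pos, eventually_ge_atTop 2] with n hn hn2
    have hn0 : (0 : ℝ) < n := by positivity
    have hlogn : 0 < Real.log n := Real.log_pos (by exact_mod_cast hn2)
    have hx := Φ.mul_le_kl_mul_expectedCount_add_log_two P θ j l hkl.ne n
      ((1 - c) * Real.log n) ?_
    · rw [div_le_div_iff₀ hκ0 hlogn, sub_mul, div_mul_cancel₀ _ hlogn.ne']
      linarith
    · have hs := Φ.sum_expectedCount P θ' n
      rw [← Finset.add_sum_erase _ _ (Finset.mem_univ j)] at hs
      rw [← Finset.sum_div] at hn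
      have hexp : Real.exp ((1 - c) * Real.log n) = n / (n : ℝ) ^ c := by
        rw [mul_comm, ← Real.rpow_def_of_pos hn0, Real.rpow_sub hn0, Real.rpow_one]
      have hpc : (0 : ℝ) < (n : ℝ) ^ c := Real.rpow_pos_of_pos hn0 c
      have hone : 1 - Φ.expectedCount P θ' j n / (N * n) =
          (∑ i ∈ Finset.univ.erase j, Φ.expectedCount P θ' i n) / (N * n) := by
        rw [eq_div_iff (by positivity), sub_mul, div_mul_cancel₀ _ (by positivity)]
        linarith
      rw [hexp, ← hθ', ← hN, hone]
      refine le_trans (le_of_eq ?_) hn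
      field_simp
  have hrE := (continuous_coe_real_ereal.tendsto _).comp hr
  rw [← hrE.liminf_eq]
  exact liminf_le_liminf (hle.mono fun n hn => by simpa using hn)

end NetworkBandit

theorem theorem2 {V Θ S : Type*} [Fintype V] [MeasurableSpace S] {K : ℕ}
    (G : SimpleGraph V) (hG : G.Connected)
    (P : Θ → Measure ℝ) [∀ a, IsProbabilityMeasure (P a)]
    (hP : ∀ a, Integrable (fun x : ℝ => x) (P a))
    (hA1 : NetworkBandit.Regular P)
    (Φ : NetworkBandit.Policy G K S) (hΦ : Φ.Consistent P)
    (θ : Fin K → Θ) (j : Fin K) (hj : NetworkBandit.IsSuboptimal P θ j)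
    (i : Fin K) (hi : NetworkBandit.IsOptimal P θ i)
    (δ : ℝ) (hδ : δ ∈ Set.Ioo (0 : ℝ) 1) :
    (((1 - δ) / (1 + δ) * (1 / (NetworkBandit.kl P (θ j) (θ i)).toReal) : ℝ) : EReal) ≤
      liminf (fun n : ℕ => ((Φ.expectedCount P θ j n / Real.log n : ℝ) : EReal)) atTop := by
  have := hG.nonempty
  obtain ⟨hδ0, hδ1⟩ := hδ
  have hji : NetworkBandit.mean P (θ j) < NetworkBandit.mean P (θ i) := by
    obtain ⟨k, hk⟩ := hj
    exact hk.trans_le (hi k)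
  obtain ⟨h0, htop⟩ := hA1.pos_finite _ _ hji
  have hκ : 0 < (NetworkBandit.kl P (θ j) (θ i)).toReal := ENNReal.toReal_pos h0.ne' htop.ne
  -- Tolerance `δ * kl (θ j) (θ i)`, so that `kl (θ j) l < (1 + δ) * kl (θ j) (θ i)`.
  obtain ⟨η, hη, hcont⟩ := hA1.continuous _ (mul_pos hδ0 hκ) _ _ hji
  obtain ⟨l, hil, hlη⟩ := hA1.dense (θ i) η hη
  obtain ⟨hl0, hltop⟩ := hA1.pos_finite _ _ (hji.trans hil)
  have hclose := hcont l hil.le hlη.le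
  have hl := hΦ.le_liminf_of_alternative P hj (fun k => (hi k).trans_lt hil) hl0 hltop hδ0
  refine le_trans (EReal.coe_le_coe_iff.2 ?_) hl
  have hκ' : 0 < (NetworkBandit.kl P (θ j) l).toReal := ENNReal.toReal_pos hl0.ne' hltop.ne
  rw [div_mul_div_comm, mul_one]
  refine div_le_div_of_nonneg_left (by linarith) hκ' ?_
  have := (abs_lt.1 hclose).1
  linarith
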